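/- Let $X=(X_1,\dots,X_L)^T$ be a random vector in $\mathbb{R}^L$ whose components have variances $\sigma_\ell^2=\mathbb{E}[(X_\ell-\mathbb{E}[X_\ell])^2]\in(0,\infty)$, $\ell=1,\dots,L$. All logarithms are natural; $x\wedge y$ denotes the minimum of $x$ and $y$; $h(X)=-\int f\log f$ is the differential entropy of $X$ if $X$ has a Lebesgue density $f$, and $h(X)=-\infty$ otherwise. Let $X^n=(X(1),\dots,X(n))$ consist of $n$ i.i.d. copies of $X$. A stochastic encoder maps $X^n$ to a codeword $M$ of a binary prefix code according to a conditional distribution $p_{M|X^n}$, and a stochastic decoder maps $M$ to $\hat X^n\in(\mathbb{R}^L)^n$ according to a conditional distribution $p_{\hat X^n|M}$, so that $p_{X^nM\hat X^n}=p_{X^n}\,p_{M|X^n}\,p_{\hat X^n|M}$. Let $\ell(M)$ be the length of $M$ and let $W_2^2(p,p')=\inf\mathbb{E}\big[\sum_{t=1}^n\|\tilde X(t)-\bar X(t)\|^2\big]$, the infimum being over all couplings of $\tilde X^n\sim p$ and $\bar X^n\sim p'$. A rate $R$ is achievable subject to $(D,P)$ if for some $n\ge 1$ there are such a prefix code, encoder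 and decoder with $$\tfrac1n\mathbb{E}[\ell(M)]\le R,\qquad \tfrac1n\mathbb{E}\Big[\sum_{t=1}^n\|X(t)-\hat X(t)\|^2\Big]\le D,\qquad \tfrac1n\mathbb{E}\big[W_2^2\big(p_{X^n|M}(\cdot|M),p_{\hat X^n|M}(\cdot|M)\big)\big]\le P.$$ Let $R_{\rm C}(D,P)\in[0,\infty]$ be the infimum of the achievable rates $R$. Let $D>0$ and $P\ge 0$, and put $$D^*=\frac{D+\sqrt{(2D-(D\wedge P))(D\wedge P)}}{2}.$$ If $D^*<\sum_{\ell=1}^L\sigma_\ell^2$, then there is a unique $\omega\in\mathbb{R}$ with $\sum_{\ell=1}^L(\omega\wedge\sigma_\ell^2)=D^*$. Put $\omega_\ell=\omega\wedge\sigma_\ell^2$ if $D^*<\sum_{\ell'=1}^L\sigma_{\ell'}^2$, and $\omega_\ell=\sigma_\ell^2$ if $D^*\ge\sum_{\ell'=1}^L\sigma_{\ell'}^2$. Then $$R_{\rm C}(D,P)\;\ge\; h(X)-\sum_{\ell=1}^L\tfrac12\log(2\pi e\,\omega_\ell),$$ and this lower bound holds also with $R_{\rm C}(D,P)$ converted from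 binary digits to nats, that is, with $R_{\rm C}(D,P)\log 2$ on the left-hand side. -/

import Mathlib

open MeasureTheory ProbabilityTheory
open scoped ENNReal NNReal

noncomputable section

namespace RDP

/-- A binary prefix code: a set of finite binary strings, none of which is a proper prefix of
another one. -/
structure BinaryPrefixCode where
  /-- the codewords -/
  words : Set (List Bool)
  /-- no codeword is a proper prefix of another codeword -/
  prefixFree : ∀ u ∈ words, ∀ v ∈ words, u <+: v → u = v

/-- The (countable) alphabet of codewords of a binary prefix code. -/
def BinaryPrefixCode.Codeword (C : BinaryPrefixCode) : Type := {w : List Bool // w ∈ C.words}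

/-- Every set of codewords is measurable. -/
instance BinaryPrefixCode.instMeasurableSpaceCodeword (C : BinaryPrefixCode) :
    MeasurableSpace C.Codeword := ⊤

/-- The length `ℓ(m)` (number of binary digits) of a codeword. -/
def BinaryPrefixCode.length (C : BinaryPrefixCode) (m : C.Codeword) : ℕ := m.1.length

/-- `q` is a joint distribution with marginals `p` and `p'`. -/
def IsCoupling {α : Type*} [MeasurableSpace α] (p p' : Measure α) (q : Measure (α × α)) : Prop :=
  q.map Prod.fst = p ∧ q.map Prod.snd = p'

/-- The optimal transport divergence
`φ(p, p') = inf_q E_q[∑ t, c (x t) (x' t)]` on distributions of sequences of length `n`, where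
`q` ranges over the couplings of `p` and `p'`. -/
def divergence {α : Type*} [MeasurableSpace α] (c : α → α → ℝ≥0∞) {n : ℕ}
    (p p' : Measure (Fin n → α)) : ℝ≥0∞ :=
  ⨅ (q : Measure ((Fin n → α) × (Fin n → α))) (_ : IsCoupling p p' q),
    ∫⁻ z, ∑ t, c (z.1 t) (z.2 t) ∂q

/-- The joint distribution `p_{X^n} p_{M|X^n} p_{X̂^n|M}` of source sequence, codeword and
reconstruction, for an i.i.d. source sequence with marginal `μ`, a stochastic encoder `enc`
and a stochastic decoder `dec`. -/
def jointLaw {α : Type*} [MeasurableSpace α] (μ : Measure α) {n : ℕ} {C : BinaryPrefixCode}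
    (enc : Kernel (Fin n → α) C.Codeword) (dec : Kernel C.Codeword (Fin n → α)) :
    Measure ((Fin n → α) × (C.Codeword × (Fin n → α))) :=
  (Measure.pi fun _ : Fin n => μ) ⊗ₘ (enc ⊗ₖ (dec.prodMkLeft (Fin n → α)))

/-- The conditional distribution `p_{X^n|M}(·|m)` under the joint distribution `J`
(used only for codewords `m` of positive probability). -/
def condSource {α : Type*} [MeasurableSpace α] {n : ℕ} {C : BinaryPrefixCode}
    (J : Measure ((Fin n → α) × (C.Codeword × (Fin n → α)))) (m : C.Codeword) :
    Measure (Fin n → α) :=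
  (cond J {z | z.2.1 = m}).map fun z => z.1

/-- The conditional distribution `p_{X̂^n|M}(·|m)` under the joint distribution `J`
(used only for codewords `m` of positive probability). -/
def condRecon {α : Type*} [MeasurableSpace α] {n : ℕ} {C : BinaryPrefixCode}
    (J : Measure ((Fin n → α) × (C.Codeword × (Fin n → α)))) (m : C.Codeword) :
    Measure (Fin n → α) :=
  (cond J {z | z.2.1 = m}).map fun z => z.2.2

/-- Rate `R` is achievable for the i.i.d. source with marginal `μ`, distortion measure `Δ` and
transport cost `c`, subject to the distortion constraint `D` and the (conditional) perception
constraint `P`: for some block length `n ≥ 1` there are a binary prefix code, a stochastic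
encoder and a stochastic decoder with `E[ℓ(M)]/n ≤ R`, `E[Δ(X^n, X̂^n)]/n ≤ D` and
`E[φ(p_{X^n|M}(·|M), p_{X̂^n|M}(·|M))]/n ≤ P`. -/
def Achievable {α : Type*} [MeasurableSpace α] (μ : Measure α) (Δ c : α → α → ℝ≥0∞)
    (D P : ℝ≥0∞) (R : ℝ≥0) : Prop :=
  ∃ n : ℕ, 1 ≤ n ∧ ∃ (C : BinaryPrefixCode)
    (enc : Kernel (Fin n → α) C.Codeword) (dec : Kernel C.Codeword (Fin n → α)),
    IsMarkovKernel enc ∧ IsMarkovKernel dec ∧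
    (∫⁻ z, (C.length z.2.1 : ℝ≥0∞) ∂(jointLaw μ enc dec)) / n ≤ R ∧
    (∫⁻ z, ∑ t, Δ (z.1 t) (z.2.2 t) ∂(jointLaw μ enc dec)) / n ≤ D ∧
    (∫⁻ z, divergence c (condSource (jointLaw μ enc dec) z.2.1)
      (condRecon (jointLaw μ enc dec) z.2.1) ∂(jointLaw μ enc dec)) / n ≤ P

/-- The operational rate-distortion-perception function `R_C(D, P)`, in binary digits per source
symbol: the infimum of the achievable rates (`∞` if there are none). -/
def operationalRDP {α : Type*} [MeasurableSpace α] (μ : Measure α) (Δ c : α → α → ℝ≥0∞)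
    (D P : ℝ≥0∞) : ℝ≥0∞ :=
  ⨅ (R : ℝ≥0) (_ : Achievable μ Δ c D P R), (R : ℝ≥0∞)

/-- Squared error `‖x - y‖²`. -/
def sqError {L : ℕ} (x y : EuclideanSpace ℝ (Fin L)) : ℝ≥0∞ := ENNReal.ofReal (‖x - y‖ ^ 2)

open Classical in
/-- Differential entropy `h = -∫ f log f` (in nats) of a distribution with Lebesgue density `f`,
as an extended real number: the integral of the positive part of `-f log f` minus that of the
negative part. It is `-∞` for a distribution without a density. -/
def differentialEntropy {L : ℕ} (μ : Measure (EuclideanSpace ℝ (Fin L))) : EReal :=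
  if μ ≪ volume then
    ((∫⁻ x, ENNReal.ofReal (Real.negMulLog (μ.rnDeriv volume x).toReal) : ℝ≥0∞) : EReal) -
      ((∫⁻ x, ENNReal.ofReal (-Real.negMulLog (μ.rnDeriv volume x).toReal) : ℝ≥0∞) : EReal)
  else ⊥

/-- `D* = (D + √((2D - (D ∧ P))(D ∧ P))) / 2`. -/
def effectiveDistortion (D P : ℝ) : ℝ :=
  (D + Real.sqrt ((2 * D - min D P) * min D P)) / 2

/-- `ω_ℓ`: equal to `ω ∧ σ²_ℓ` if `Dstar < ∑ σ²_ℓ'`, and to `σ²_ℓ` otherwise. -/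
def waterFill {L : ℕ} (σsq : Fin L → ℝ) (Dstar ω : ℝ) (l : Fin L) : ℝ :=
  if Dstar < ∑ k, σsq k then min ω (σsq l) else σsq l

end RDP

end

/-!
The key is a Gibbs-type inequality that bypasses conditional entropies. Write `f` for the density
of the source, `c m = E[Xⁿ | M = m]`, and `g m` for the Gaussian product density on blocks with
mean `c m` and coordinate variances equal to the water-filling levels `ω l`, the same for every
codeword `m`. By Kraft's inequality the mixture `G = ∑ₘ 2 ^ (-ℓ(m)) g m` has total mass at most
one, so that `E[G(Xⁿ) / ∏ₜ f(X(t))] ≤ 1`. Since `2 ^ (-ℓ(m)) g m ≤ G` pointwise, `log r ≤ r - 1`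
gives, after integration (`RDP.card_mul_entropy_le`),
`n h(X) ≤ E[ℓ(M)] log 2 + ∑ₜ ∑ₗ (log (2π ω l) / 2 + s t l / (2 ω l))`,
where `s t l` is the mean squared error of `c M` in coordinate `l` at time `t`. It remains to
see that the time averages of `s t l`, divided by `ω l`, add up to at most `L`. This is the
first-order optimality of water filling (`RDP.sum_div_waterFill_le`), given two facts.

* `s t l ≤ σ²ₗ`, as the conditional mean predicts better than the mean
  (`RDP.lintegral_sq_sub_decoderMean_le`).
* `∑ₜ ∑ₗ s t l ≤ n D*` (`RDP.lintegral_sum_sqError_decoderMean_le`). Let `V` be the left-hand side,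
  and `B` the mean squared distance of the reconstruction from `c M`. Source and reconstruction are
  independent given `M`, so the distortion is `V + B ≤ n D`. The triangle inequality for couplings
  of the two conditional laws, in the form `V ≤ (1 + a) W + (1 + a⁻¹) B` for every `a > 0`, is
  linear in the expected transport cost `W ≤ n P`, so it can be averaged over codewords without
  Minkowski's inequality. Optimizing over `a` gives `V ≤ n D*`
  (`RDP.le_effectiveDistortion`).

Second moments make the positive part of `-log f` integrable, so the differential entropy is either
`-∞`, where nothing is to be proved, or the expectation of `-log f`
(`RDP.differentialEntropy_eq`).
-/

noncomputable section

namespace RDP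

/-! ### Integrals of products -/

/-- **Tonelli's theorem** for a product of functions of one coordinate each. -/
theorem lintegral_fin_pi_prod {n : ℕ} {E : Fin n → Type*} {mE : ∀ i, MeasurableSpace (E i)}
    (ν : (i : Fin n) → Measure (E i)) [∀ i, SigmaFinite (ν i)] (f : (i : Fin n) → E i → ℝ≥0∞)
    (hf : ∀ i, Measurable (f i)) :
    ∫⁻ x : (i : Fin n) → E i, ∏ i, f i (x i) ∂(Measure.pi ν) = ∏ i, ∫⁻ x, f i x ∂(ν i) := by
  induction n with
  | zero => simp
  | succ n ih =>
    have hm : Measurable fun x : (i : Fin n) → E (Fin.succ i) =>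
        ∏ i : Fin n, f (Fin.succ i) (x i) :=
      Finset.measurable_prod _ fun i _ => (hf i.succ).comp (measurable_pi_apply i)
    calc
      _ = ∫⁻ x : E 0 × ((i : Fin n) → E (Fin.succ i)),
          f 0 x.1 * ∏ i : Fin n, f (Fin.succ i) (x.2 i)
          ∂((ν 0).prod (Measure.pi (fun i ↦ ν i.succ))) := by
        refine (((measurePreserving_piFinSuccAbove ν 0).symm).lintegral_comp
          (f := fun x => ∏ i, f i (x i))
          (Finset.measurable_prod _ fun i _ => (hf i).comp (measurable_pi_apply i))).symm.trans ?_
        refine lintegral_congr fun x => ?_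
        rw [Fin.prod_univ_succ]
        rfl
      _ = (∫⁻ x, f 0 x ∂ν 0)
          * ∏ i : Fin n, ∫⁻ (x : E (Fin.succ i)), f (Fin.succ i) x ∂(ν i.succ) := by
        rw [← ih (fun i => ν i.succ) (fun i => f i.succ) (fun i => hf i.succ),
          ← lintegral_prod_mul (hf 0).aemeasurable hm.aemeasurable]
      _ = ∏ i, ∫⁻ x, f i x ∂(ν i) := by rw [Fin.prod_univ_succ]

/-! ### Gaussian densities -/

/-- The density on `ℝ^L` of a Gaussian vector with independent coordinates of means `c l` and
variances `v l`. -/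
def gaussianDensity {L : ℕ} (c : Fin L → ℝ) (v : Fin L → ℝ≥0) (x : EuclideanSpace ℝ (Fin L)) :
    ℝ≥0∞ :=
  ∏ l, gaussianPDF (c l) (v l) (x l)

theorem measurable_coord {L : ℕ} (l : Fin L) :
    Measurable fun x : EuclideanSpace ℝ (Fin L) => x l := by fun_prop

theorem measurable_gaussianDensity {L : ℕ} (c : Fin L → ℝ) (v : Fin L → ℝ≥0) :
    Measurable (gaussianDensity c v) :=
  Finset.measurable_prod _ fun l _ => (measurable_gaussianPDF (c l) (v l)).comp (measurable_coord l)

theorem lintegral_gaussianDensity {L : ℕ} (c : Fin L → ℝ) {v : Fin L → ℝ≥0} (hv : ∀ l, v l ≠ 0) :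
    ∫⁻ x, gaussianDensity c v x = 1 := by
  rw [← (PiLp.volume_preserving_toLp (Fin L)).lintegral_comp (measurable_gaussianDensity c v)]
  simp only [gaussianDensity]
  rw [volume_pi, lintegral_fin_pi_prod _ (fun l => gaussianPDF (c l) (v l))
    fun l => measurable_gaussianPDF (c l) (v l)]
  exact Finset.prod_eq_one fun l _ => lintegral_gaussianPDF_eq_one _ (hv l)

theorem gaussianDensity_pos {L : ℕ} (c : Fin L → ℝ) {v : Fin L → ℝ≥0} (hv : ∀ l, v l ≠ 0)
    (x : EuclideanSpace ℝ (Fin L)) : 0 < (gaussianDensity c v x).toReal := by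
  simp only [gaussianDensity, ENNReal.toReal_prod, toReal_gaussianPDF]
  exact Finset.prod_pos fun l _ => gaussianPDFReal_pos _ _ _ (hv l)

theorem neg_log_gaussianDensity {L : ℕ} (c : Fin L → ℝ) {v : Fin L → ℝ≥0} (hv : ∀ l, v l ≠ 0)
    (x : EuclideanSpace ℝ (Fin L)) :
    -Real.log (gaussianDensity c v x).toReal =
      ∑ l, (1 / 2 * Real.log (2 * Real.pi * v l) + (x l - c l) ^ 2 / (2 * v l)) := by
  simp only [gaussianDensity, ENNReal.toReal_prod, toReal_gaussianPDF]
  rw [Real.log_prod fun l _ => (gaussianPDFReal_pos _ _ _ (hv l)).ne', ← Finset.sum_neg_distrib]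
  refine Finset.sum_congr rfl fun l _ => ?_
  have hvl : (0 : ℝ) < v l := by exact_mod_cast pos_iff_ne_zero.mpr (hv l)
  have h2 : 0 < 2 * Real.pi * v l := by positivity
  rw [gaussianPDFReal, Real.log_mul (by positivity) (Real.exp_pos _).ne', Real.log_exp,
    Real.log_inv, Real.log_sqrt h2.le]
  ring

/-! ### Differential entropy -/

/-- Only an inequality, as `g` may have mass where the density of `μ` vanishes. -/
theorem lintegral_div_rnDeriv_le {E : Type*} [MeasurableSpace E] {μ ν : Measure E}
    [SigmaFinite μ] [SigmaFinite ν] (h : μ ≪ ν) {g : E → ℝ≥0∞} (hg : Measurable g) :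
    ∫⁻ x, g x / μ.rnDeriv ν x ∂μ ≤ ∫⁻ x, g x ∂ν := by
  rw [← lintegral_rnDeriv_mul h (f := fun x => g x / μ.rnDeriv ν x)
    (hg.div (Measure.measurable_rnDeriv μ ν)).aemeasurable]
  exact lintegral_mono fun x => ENNReal.mul_div_le

theorem rnDeriv_toReal_pos {E : Type*} [MeasurableSpace E] {μ ν : Measure E}
    [SigmaFinite μ] [SigmaFinite ν] (h : μ ≪ ν) : ∀ᵐ x ∂μ, 0 < (μ.rnDeriv ν x).toReal := by
  filter_upwards [Measure.rnDeriv_pos h, h.ae_le (Measure.rnDeriv_lt_top μ ν)] with x h1 h2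
  exact ENNReal.toReal_pos h1.ne' h2.ne
open Real in
/-- If the coordinates of a random vector have second moments, the positive part of `-log f` is
integrable: compare the density `f` with a standard Gaussian density. -/
theorem lintegral_neg_log_rnDeriv_lt_top {L : ℕ} {μ : Measure (EuclideanSpace ℝ (Fin L))}
    [IsProbabilityMeasure μ]
    (hfin : ∀ l, MemLp (fun x : EuclideanSpace ℝ (Fin L) => x l) 2 μ) (hac : μ ≪ volume) :
    ∫⁻ x, ENNReal.ofReal (-log (μ.rnDeriv volume x).toReal) ∂μ < ⊤ := by
  set g : EuclideanSpace ℝ (Fin L) → ℝ≥0∞ := gaussianDensity (fun _ => 0) (fun _ => 1) with hg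
  have hv : ∀ l : Fin L, (1 : ℝ≥0) ≠ 0 := fun _ => one_ne_zero
  have hq : Integrable (fun x => -log (g x).toReal) μ := by
    simp only [hg, neg_log_gaussianDensity _ hv]
    refine integrable_finsetSum _ fun l _ => (integrable_const _).add (Integrable.div_const ?_ _)
    simpa using (hfin l).integrable_sq
  have hle : ∀ᵐ x ∂μ, ENNReal.ofReal (-log (μ.rnDeriv volume x).toReal) ≤
      g x / μ.rnDeriv volume x + ENNReal.ofReal (-log (g x).toReal) := by
    filter_upwards [rnDeriv_toReal_pos hac] with x hx
    have hgx : 0 < (g x).toReal := gaussianDensity_pos _ hv x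
    have h1 := log_le_sub_one_of_pos (div_pos hgx hx)
    rw [log_div hgx.ne' hx.ne'] at h1
    calc _ ≤ ENNReal.ofReal ((g x / μ.rnDeriv volume x).toReal + -log (g x).toReal) := by
          apply ENNReal.ofReal_le_ofReal
          rw [ENNReal.toReal_div]
          linarith
      _ ≤ _ := ENNReal.ofReal_add_le.trans (by gcongr; exact ENNReal.ofReal_toReal_le)
  calc _ ≤ ∫⁻ x, (g x / μ.rnDeriv volume x + ENNReal.ofReal (-log (g x).toReal)) ∂μ :=
        lintegral_mono_ae hle
    _ = ∫⁻ x, g x / μ.rnDeriv volume x ∂μ + ∫⁻ x, ENNReal.ofReal (-log (g x).toReal) ∂μ :=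
        lintegral_add_left ((measurable_gaussianDensity _ _).div
          (Measure.measurable_rnDeriv μ volume)) _
    _ < ⊤ := by
        refine ENNReal.add_lt_top.mpr ⟨?_, hq.lintegral_lt_top⟩
        refine (lintegral_div_rnDeriv_le hac (measurable_gaussianDensity _ _)).trans_lt ?_
        rw [lintegral_gaussianDensity _ hv]
        exact ENNReal.one_lt_top

open Real in
theorem lintegral_ofReal_mul_rnDeriv {E : Type*} [MeasurableSpace E] {μ ν : Measure E}
    [SigmaFinite μ] [SigmaFinite ν] (h : μ ≪ ν) {F : ℝ → ℝ} (hF : Measurable F) :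
    ∫⁻ x, ENNReal.ofReal ((μ.rnDeriv ν x).toReal * F (μ.rnDeriv ν x).toReal) ∂ν =
      ∫⁻ x, ENNReal.ofReal (F (μ.rnDeriv ν x).toReal) ∂μ := by
  have hm := Measure.measurable_rnDeriv μ ν
  rw [← lintegral_rnDeriv_mul h (by fun_prop)]
  refine lintegral_congr_ae ?_
  filter_upwards [Measure.rnDeriv_lt_top μ ν] with x hx
  rw [ENNReal.ofReal_mul ENNReal.toReal_nonneg, ENNReal.ofReal_toReal hx.ne]

open Real in
/-- With second moments, the differential entropy is either `-∞` or the finite expectation of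
`-log f`. -/
theorem differentialEntropy_eq {L : ℕ} {μ : Measure (EuclideanSpace ℝ (Fin L))}
    [IsProbabilityMeasure μ]
    (hfin : ∀ l, MemLp (fun x : EuclideanSpace ℝ (Fin L) => x l) 2 μ)
    (hne : differentialEntropy μ ≠ ⊥) :
    μ ≪ volume ∧ Integrable (fun x => -log (μ.rnDeriv volume x).toReal) μ ∧
      differentialEntropy μ = ((∫ x, -log (μ.rnDeriv volume x).toReal ∂μ : ℝ) : EReal) := by
  have hac : μ ≪ volume := by
    by_contra h
    exact hne (by rw [differentialEntropy, if_neg h])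
  have hm := Measure.measurable_rnDeriv μ volume
  have hA := lintegral_neg_log_rnDeriv_lt_top hfin hac
  have hent : differentialEntropy μ =
      ((∫⁻ x, ENNReal.ofReal (-log (μ.rnDeriv volume x).toReal) ∂μ : ℝ≥0∞) : EReal) -
        ((∫⁻ x, ENNReal.ofReal (- -log (μ.rnDeriv volume x).toReal) ∂μ : ℝ≥0∞) : EReal) := by
    rw [differentialEntropy, if_pos hac,
      ← lintegral_ofReal_mul_rnDeriv hac (F := fun y => -log y) (by fun_prop),
      ← lintegral_ofReal_mul_rnDeriv hac (F := fun y => - -log y) (by fun_prop)]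
    simp only [negMulLog, neg_mul, mul_neg]
  have hB : ∫⁻ x, ENNReal.ofReal (- -log (μ.rnDeriv volume x).toReal) ∂μ ≠ ⊤ := by
    intro h
    rw [hent, h] at hne
    exact hne (by simp [EReal.sub_top])
  have hint : Integrable (fun x => -log (μ.rnDeriv volume x).toReal) μ := by
    refine ⟨(measurable_log.comp hm.ennreal_toReal).neg.aestronglyMeasurable, ?_⟩
    rw [hasFiniteIntegral_iff_norm]
    refine lt_of_le_of_lt (lintegral_mono fun x => ?_) (lt_of_eq_of_lt
      (lintegral_add_left (f := fun x => ENNReal.ofReal (-log (μ.rnDeriv volume x).toReal))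
        (by fun_prop) fun x => ENNReal.ofReal (- -log (μ.rnDeriv volume x).toReal))
      (ENNReal.add_lt_top.mpr ⟨hA, hB.lt_top⟩))
    rcases le_total 0 (-log (μ.rnDeriv volume x).toReal) with h | h
    · rw [norm_of_nonneg h]; exact le_self_add
    · rw [norm_of_nonpos h]; exact le_add_self
  refine ⟨hac, hint, ?_⟩
  rw [hent, integral_eq_lintegral_pos_part_sub_lintegral_neg_part hint, EReal.coe_sub,
    EReal.coe_ennreal_toReal hA.ne, EReal.coe_ennreal_toReal hB]

/-! ### Kraft's inequality -/

/-- A prefix-free set of nonempty words is uniquely decodable. -/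
theorem uniquelyDecodable_of_prefixFree {S : Set (List Bool)} (h0 : [] ∉ S)
    (hS : ∀ u ∈ S, ∀ v ∈ S, u <+: v → u = v) : InformationTheory.UniquelyDecodable S := by
  intro L₁
  induction L₁ with
  | nil =>
    intro L₂ _ h₂ h
    cases L₂ with
    | nil => rfl
    | cons v L₂ =>
      rw [List.flatten_nil, List.flatten_cons] at h
      have hv : v = [] := (List.append_eq_nil_iff.mp h.symm).1
      exact absurd (hv ▸ h₂ v (by simp)) h0
  | cons u L₁ ih =>
    intro L₂ h₁ h₂ h
    cases L₂ with
    | nil =>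
      rw [List.flatten_nil, List.flatten_cons] at h
      have hu : u = [] := (List.append_eq_nil_iff.mp h).1
      exact absurd (hu ▸ h₁ u (by simp)) h0
    | cons v L₂ =>
      rw [List.flatten_cons, List.flatten_cons] at h
      have hu := h₁ u (by simp)
      have hv := h₂ v (by simp)
      have huv : u = v := by
        have h3 : u <+: v ++ L₂.flatten := h ▸ List.prefix_append _ _
        rcases List.prefix_or_prefix_of_prefix h3 (List.prefix_append v _) with h4 | h4
        · exact hS u hu v hv h4
        · exact (hS v hv u hu h4).symm
      subst huv
      rw [ih L₂ (fun w hw => h₁ w (by simp [hw])) (fun w hw => h₂ w (by simp [hw]))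
        (List.append_cancel_left h)]

theorem BinaryPrefixCode.sum_kraft_le_one (C : BinaryPrefixCode) (T : Finset (List Bool))
    (hT : ∀ w ∈ T, w ∈ C.words) : ∑ w ∈ T, (1 / 2 : ℝ) ^ w.length ≤ 1 := by
  -- the code `{[]}` is prefix free but not uniquely decodable
  by_cases h0 : [] ∈ T
  · have hT' : T ⊆ {[]} := fun w hw => by
      rw [Finset.mem_singleton]
      exact (C.prefixFree [] (hT _ h0) w (hT w hw) List.nil_prefix).symm
    calc _ ≤ ∑ w ∈ ({[]} : Finset (List Bool)), (1 / 2 : ℝ) ^ w.length :=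
          Finset.sum_le_sum_of_subset_of_nonneg hT' fun _ _ _ => by positivity
      _ = 1 := by simp
  · have := InformationTheory.kraft_mcmillan_inequality (S := T)
      (uniquelyDecodable_of_prefixFree (by simpa using h0) fun u hu v hv =>
        C.prefixFree u (hT u hu) v (hT v hv))
    simpa using this

/-- The weight `2 ^ (-ℓ(m))` of a codeword. -/
def BinaryPrefixCode.weight (C : BinaryPrefixCode) (m : C.Codeword) : ℝ≥0∞ :=
  ENNReal.ofReal ((1 / 2) ^ C.length m)

/-- Kraft's inequality for a possibly infinite binary prefix code. -/
theorem BinaryPrefixCode.tsum_weight_le_one (C : BinaryPrefixCode) :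
    ∑' m, C.weight m ≤ 1 := by
  rw [ENNReal.tsum_eq_iSup_sum]
  refine iSup_le fun T => ?_
  simp only [weight, length]
  rw [← ENNReal.ofReal_sum_of_nonneg fun _ _ => by positivity, ← ENNReal.ofReal_one]
  refine ENNReal.ofReal_le_ofReal ?_
  let e : C.Codeword ↪ List Bool := ⟨fun m => m.1, fun _ _ h => Subtype.ext h⟩
  have h := C.sum_kraft_le_one (T.map e) fun w hw => by
    obtain ⟨m, -, rfl⟩ := Finset.mem_map.mp hw
    exact m.2
  rwa [Finset.sum_map] at h

/-! ### Water filling and the effective distortion -/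

theorem existsUnique_waterLevel {L : ℕ} {σsq : Fin L → ℝ} (hpos : ∀ l, 0 < σsq l) {d : ℝ}
    (hd : 0 < d) (hlt : d < ∑ l, σsq l) : ∃! ω : ℝ, ∑ l, min ω (σsq l) = d := by
  have hcont : Continuous fun ω : ℝ => ∑ l, min ω (σsq l) :=
    continuous_finsetSum _ fun l _ => continuous_id.min continuous_const
  have hS : 0 ≤ ∑ l, σsq l := Finset.sum_nonneg fun l _ => (hpos l).le
  have h0 : ∑ l, min 0 (σsq l) ≤ d := by
    simp only [min_eq_left (hpos _).le, Finset.sum_const_zero, hd.le]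
  have h1 : d ≤ ∑ l, min (∑ k, σsq k) (σsq l) := by
    refine hlt.le.trans (Finset.sum_le_sum fun l _ => ?_)
    exact le_min (Finset.single_le_sum (f := σsq) (fun k _ => (hpos k).le) (Finset.mem_univ l))
      le_rfl
  obtain ⟨ω, -, hω⟩ := intermediate_value_Icc hS hcont.continuousOn ⟨h0, h1⟩
  -- equal sums force `min ω₁ (σsq l) = min ω₂ (σsq l)` for every `l`, hence `σsq l ≤ ω₁`
  have key : ∀ ω₁ ω₂ : ℝ, ω₁ < ω₂ →
      ∑ l, min ω₁ (σsq l) = d → ∑ l, min ω₂ (σsq l) = d → False := by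
    intro ω₁ ω₂ h12 e1 e2
    have heq := (Finset.sum_eq_sum_iff_of_le (s := Finset.univ)
      (f := fun l => min ω₁ (σsq l)) (g := fun l => min ω₂ (σsq l))
      fun l _ => min_le_min_right _ h12.le).mp (e1.trans e2.symm)
    have h3 : ∀ l, min ω₁ (σsq l) = σsq l := fun l => by
      have h4 : min ω₁ (σsq l) = min ω₂ (σsq l) := heq l (Finset.mem_univ l)
      refine min_eq_right (not_lt.mp fun h5 => ?_)
      rw [min_eq_left h5.le] at h4
      exact (lt_min h12 h5).ne h4
    simp only [h3] at e1
    exact hlt.ne' e1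
  refine ⟨ω, hω, fun ω' hω' => ?_⟩
  rcases lt_trichotomy ω' ω with h | h | h
  · exact (key _ _ h hω' hω).elim
  · exact h
  · exact (key _ _ h hω hω').elim

theorem waterLevel_pos {L : ℕ} {σsq : Fin L → ℝ} {d ω : ℝ} (hd : 0 < d)
    (hω : ∑ l, min ω (σsq l) = d) : 0 < ω := by
  by_contra h
  have : ∑ l, min ω (σsq l) ≤ 0 :=
    Finset.sum_nonpos fun l _ => (min_le_left _ _).trans (not_lt.mp h)
  linarith

theorem effectiveDistortion_pos {D P : ℝ} (hD : 0 < D) : 0 < effectiveDistortion D P := by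
  have := Real.sqrt_nonneg ((2 * D - min D P) * min D P)
  rw [effectiveDistortion]
  linarith

theorem waterFill_pos {L : ℕ} {σsq : Fin L → ℝ} (hpos : ∀ l, 0 < σsq l) {d ω : ℝ} (hd : 0 < d)
    (hω : d < ∑ l, σsq l → ∑ l, min ω (σsq l) = d) (l : Fin L) : 0 < waterFill σsq d ω l := by
  rw [waterFill]
  split_ifs with h
  · exact lt_min (waterLevel_pos hd (hω h)) (hpos l)
  · exact hpos l

/-- First-order optimality of water filling: for allocations `v ≤ σ²` of total at most `d`, the
derivative of `∑ log` at the water-filling allocation in the direction of `v` is nonpositive. -/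
theorem sum_div_waterFill_le {L : ℕ} {σsq : Fin L → ℝ} (hpos : ∀ l, 0 < σsq l) {d ω : ℝ}
    (hd : 0 < d) (hω : d < ∑ l, σsq l → ∑ l, min ω (σsq l) = d) {v : Fin L → ℝ}
    (hv : ∀ l, v l ≤ σsq l) (hsum : ∑ l, v l ≤ d) : ∑ l, v l / waterFill σsq d ω l ≤ L := by
  by_cases h : d < ∑ l, σsq l
  · have hω0 := waterLevel_pos hd (hω h)
    have hterm : ∀ l, v l / waterFill σsq d ω l ≤ 1 + (v l - min ω (σsq l)) / ω := by
      intro l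
      rw [waterFill, if_pos h]
      rcases le_total ω (σsq l) with h1 | h1
      · rw [min_eq_left h1, sub_div, div_self hω0.ne']
        linarith
      · rw [min_eq_right h1]
        have h2 := hpos l
        have h3 : (σsq l - v l) / ω ≤ (σsq l - v l) / σsq l :=
          div_le_div_of_nonneg_left (by linarith [hv l]) h2 h1
        rw [sub_div, sub_div, div_self h2.ne'] at h3
        rw [sub_div]
        linarith
    calc _ ≤ ∑ l, (1 + (v l - min ω (σsq l)) / ω) := Finset.sum_le_sum fun l _ => hterm l
      _ = L + (∑ l, v l - ∑ l, min ω (σsq l)) / ω := by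
          rw [Finset.sum_add_distrib, ← Finset.sum_div, Finset.sum_sub_distrib]; simp
      _ ≤ L := by
          have : (∑ l, v l - ∑ l, min ω (σsq l)) / ω ≤ 0 :=
            div_nonpos_of_nonpos_of_nonneg (by linarith [hω h]) hω0.le
          linarith
  · calc _ ≤ ∑ _l : Fin L, (1 : ℝ) := Finset.sum_le_sum fun l _ => by
          rw [waterFill, if_neg h]
          exact div_le_one_of_le₀ (hv l) (hpos l).le
      _ = L := by simp

/-- If an estimation error `V` and a remainder `B` satisfy `V + B ≤ D` and
`√V ≤ √P + √B`, the latter in the form of a family of linear inequalities, then `V ≤ D*`. -/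
theorem le_effectiveDistortion {D P V B : ℝ} (hD : 0 < D) (hP : 0 ≤ P) (hB : 0 ≤ B)
    (hVB : V + B ≤ D) (h : ∀ a : ℝ, 0 < a → V ≤ (1 + a) * P + (1 + a⁻¹) * B) :
    V ≤ effectiveDistortion D P := by
  rw [effectiveDistortion]
  rcases le_or_gt D P with hDP | hDP
  · rw [min_eq_left hDP, show (2 * D - D) * D = D ^ 2 by ring, Real.sqrt_sq hD.le]
    linarith
  rw [min_eq_right hDP.le]
  have h' : ∀ a : ℝ, 0 < a → V * (2 * a + 1) ≤ a * (1 + a) * P + (1 + a) * D := by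
    intro a ha
    have h1 := mul_le_mul_of_nonneg_left (h a ha) ha.le
    have h2 : a * ((1 + a) * P + (1 + a⁻¹) * B) = a * (1 + a) * P + (a + 1) * B := by
      field_simp
    rw [h2] at h1
    nlinarith
  rcases hP.eq_or_lt with rfl | hP0
  · simp only [sub_zero, mul_zero, Real.sqrt_zero, add_zero]
    by_contra hcon
    push Not at hcon
    have hpos : 0 < 2 * V - D := by linarith
    -- for `P = 0` the infimum is reached only as `a → ∞`; this `a` is large enough
    have h3 := h' (D / (2 * V - D)) (by positivity)
    have h4 : D / (2 * V - D) * (2 * V - D) = D := div_mul_cancel₀ _ hpos.ne'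
    nlinarith
  · obtain ⟨p, hp, rfl⟩ : ∃ p : ℝ, 0 < p ∧ p ^ 2 = P :=
      ⟨√P, Real.sqrt_pos.mpr hP0, Real.sq_sqrt hP⟩
    obtain ⟨r, hr, hrD⟩ : ∃ r : ℝ, 0 < r ∧ r ^ 2 = 2 * D - p ^ 2 :=
      ⟨√(2 * D - p ^ 2), Real.sqrt_pos.mpr (by linarith), Real.sq_sqrt (by linarith)⟩
    have hpr : p < r := by
      apply lt_of_pow_lt_pow_left₀ 2 hr.le
      linarith
    rw [← hrD, ← mul_pow, Real.sqrt_sq (by positivity)]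
    -- the value of `a` that minimizes the bound on `V`
    have h3 := h' ((r - p) / (2 * p)) (div_pos (by linarith) (by linarith))
    have hDe : D = (r ^ 2 + p ^ 2) / 2 := by linarith
    rw [hDe] at h3 ⊢
    have h4 : V * r ≤ (((r ^ 2 + p ^ 2) / 2 + r * p) / 2) * r := by
      field_simp at h3 ⊢
      nlinarith
    exact le_of_mul_le_mul_right h4 hr

/-! ### Squared error and transport cost -/

theorem sqError_eq_sum {L : ℕ} (x y : EuclideanSpace ℝ (Fin L)) :
    sqError x y = ∑ l, ENNReal.ofReal ((x l - y l) ^ 2) := by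
  rw [sqError, EuclideanSpace.norm_sq_eq, ENNReal.ofReal_sum_of_nonneg fun _ _ => sq_nonneg _]
  simp

theorem sqError_comm {L : ℕ} (x y : EuclideanSpace ℝ (Fin L)) : sqError x y = sqError y x := by
  rw [sqError, sqError, norm_sub_rev]

@[fun_prop]
theorem _root_.Measurable.sqError {L : ℕ} {α : Type*} [MeasurableSpace α]
    {f g : α → EuclideanSpace ℝ (Fin L)} (hf : Measurable f) (hg : Measurable g) :
    Measurable fun a => RDP.sqError (f a) (g a) := by
  simp only [RDP.sqError]
  fun_prop

/-- A weighted form of the triangle inequality for the Euclidean norm. -/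
theorem sqError_le_add {L : ℕ} (x y c : EuclideanSpace ℝ (Fin L)) {a : ℝ} (ha : 0 < a) :
    sqError x c ≤ ENNReal.ofReal (1 + a) * sqError x y + ENNReal.ofReal (1 + a⁻¹) * sqError y c := by
  have ha' : 0 < a⁻¹ := inv_pos.mpr ha
  rw [sqError, sqError, sqError, ← ENNReal.ofReal_mul (by positivity),
    ← ENNReal.ofReal_mul (by positivity), ← ENNReal.ofReal_add (by positivity) (by positivity)]
  refine ENNReal.ofReal_le_ofReal ?_
  have h1 : ‖x - c‖ ≤ ‖x - y‖ + ‖y - c‖ := norm_sub_le_norm_sub_add_norm_sub x y c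
  have h2 : ‖x - c‖ ^ 2 ≤ (‖x - y‖ + ‖y - c‖) ^ 2 := by gcongr
  -- `2 ‖x - y‖ ‖y - c‖ ≤ a ‖x - y‖² + a⁻¹ ‖y - c‖²`
  have h3 : 0 ≤ a⁻¹ * (a * ‖x - y‖ - ‖y - c‖) ^ 2 := by positivity
  have h4 : a⁻¹ * (a * ‖x - y‖ - ‖y - c‖) ^ 2 =
      a * ‖x - y‖ ^ 2 - 2 * ‖x - y‖ * ‖y - c‖ + a⁻¹ * ‖y - c‖ ^ 2 := by
    field_simp
    ring
  nlinarith

/-- Bias-variance decomposition of the mean squared error of the constant predictor `a`. -/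
theorem lintegral_sq_sub_eq {Ω : Type*} [MeasurableSpace Ω] {ν : Measure Ω}
    [IsProbabilityMeasure ν] {X : Ω → ℝ} (hX : MemLp X 2 ν) (a : ℝ) :
    ∫⁻ x, ENNReal.ofReal ((X x - a) ^ 2) ∂ν =
      ∫⁻ x, ENNReal.ofReal ((X x - ∫ x', X x' ∂ν) ^ 2) ∂ν +
        ENNReal.ofReal ((∫ x', X x' ∂ν - a) ^ 2) := by
  set c := ∫ x', X x' ∂ν with hc
  have hX1 : Integrable X ν := hX.integrable one_le_two
  have hi : ∀ b : ℝ, Integrable (fun x => (X x - b) ^ 2) ν := fun b =>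
    (hX.sub (memLp_const b)).integrable_sq
  rw [← ofReal_integral_eq_lintegral_ofReal (hi a) (ae_of_all _ fun _ => sq_nonneg _),
    ← ofReal_integral_eq_lintegral_ofReal (hi c) (ae_of_all _ fun _ => sq_nonneg _),
    ← ENNReal.ofReal_add (integral_nonneg fun _ => sq_nonneg _) (sq_nonneg _)]
  congr 1
  have h1 : ∀ x, (X x - a) ^ 2 = (X x - c) ^ 2 + (2 * (c - a) * (X x - c) + (c - a) ^ 2) :=
    fun x => by ring
  simp only [h1]
  have h2 : Integrable (fun x => X x - c) ν := hX1.sub (integrable_const c)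
  have h3 : Integrable (fun x => 2 * (c - a) * (X x - c)) ν := h2.const_mul _
  have h4 : Integrable (fun x => 2 * (c - a) * (X x - c) + (c - a) ^ 2) ν :=
    h3.add (integrable_const _)
  rw [integral_add (hi c) h4, integral_add h3 (integrable_const _),
    integral_const_mul, integral_sub hX1 (integrable_const c)]
  simp [← hc]

/-- The vector of means of the coordinates of a random sequence of vectors. -/
def blockMean {L n : ℕ} (ν : Measure (Fin n → EuclideanSpace ℝ (Fin L))) (t : Fin n) :
    EuclideanSpace ℝ (Fin L) :=
  WithLp.toLp 2 fun l => ∫ x, x t l ∂ν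

theorem blockMean_apply {L n : ℕ} (ν : Measure (Fin n → EuclideanSpace ℝ (Fin L))) (t : Fin n)
    (l : Fin L) : blockMean ν t l = ∫ x, x t l ∂ν := rfl

section Block

variable {L n : ℕ} {ν ρ : Measure (Fin n → EuclideanSpace ℝ (Fin L))}

/-- Bias-variance decomposition of the squared error of the constant sequence `y`. -/
theorem lintegral_sum_sqError_eq [IsProbabilityMeasure ν]
    (hν : ∀ t l, MemLp (fun x : Fin n → EuclideanSpace ℝ (Fin L) => x t l) 2 ν)
    (y : Fin n → EuclideanSpace ℝ (Fin L)) :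
    ∫⁻ x, ∑ t, sqError (x t) (y t) ∂ν =
      ∫⁻ x, ∑ t, sqError (x t) (blockMean ν t) ∂ν + ∑ t, sqError (y t) (blockMean ν t) := by
  rw [lintegral_finsetSum _ fun t _ => by fun_prop, lintegral_finsetSum _ fun t _ => by fun_prop,
    ← Finset.sum_add_distrib]
  refine Finset.sum_congr rfl fun t _ => ?_
  rw [sqError_comm (y t)]
  simp only [sqError_eq_sum]
  rw [lintegral_finsetSum _ fun l _ => by fun_prop, lintegral_finsetSum _ fun l _ => by fun_prop,
    ← Finset.sum_add_distrib]
  exact Finset.sum_congr rfl fun l _ => lintegral_sq_sub_eq (hν t l) (y t l)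

/-- The expected squared error between independent sequences `x ∼ ν` and `y ∼ ρ` is the sum of
their expected squared errors with respect to the mean of `ν`. -/
theorem lintegral_lintegral_sum_sqError_eq [IsProbabilityMeasure ν] [IsProbabilityMeasure ρ]
    (hν : ∀ t l, MemLp (fun x : Fin n → EuclideanSpace ℝ (Fin L) => x t l) 2 ν) :
    ∫⁻ x, ∫⁻ y, ∑ t, sqError (x t) (y t) ∂ρ ∂ν =
      ∫⁻ x, ∑ t, sqError (x t) (blockMean ν t) ∂ν +
        ∫⁻ y, ∑ t, sqError (y t) (blockMean ν t) ∂ρ := by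
  rw [lintegral_lintegral_swap (by fun_prop)]
  rw [lintegral_congr fun y => lintegral_sum_sqError_eq hν y, lintegral_add_left measurable_const,
    lintegral_const, measure_univ, mul_one]

/-- A linearized triangle inequality for the transport distance from `ν` to the point mass at any
sequence `c`, via `ρ`. -/
theorem lintegral_sum_sqError_le_divergence (c : Fin n → EuclideanSpace ℝ (Fin L)) {a : ℝ}
    (ha : 0 < a) :
    ∫⁻ x, ∑ t, sqError (x t) (c t) ∂ν ≤ ENNReal.ofReal (1 + a) * divergence sqError ν ρ +
      ENNReal.ofReal (1 + a⁻¹) * ∫⁻ y, ∑ t, sqError (y t) (c t) ∂ρ := by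
  have hne : ENNReal.ofReal (1 + a) ≠ 0 := (ENNReal.ofReal_pos.mpr (by positivity)).ne'
  simp only [divergence, ENNReal.mul_iInf_of_ne hne ENNReal.ofReal_ne_top, ENNReal.iInf_add]
  refine le_iInf₂ fun q hq => ?_
  have hm : Measurable fun x : Fin n → EuclideanSpace ℝ (Fin L) => ∑ t, sqError (x t) (c t) := by
    fun_prop
  rw [← hq.1, ← hq.2, lintegral_map hm measurable_fst, lintegral_map hm measurable_snd,
    ← lintegral_const_mul _ (by fun_prop), ← lintegral_const_mul _ (by fun_prop),
    ← lintegral_add_left (by fun_prop)]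
  refine lintegral_mono fun z => ?_
  simp only [Finset.mul_sum, ← Finset.sum_add_distrib]
  exact Finset.sum_le_sum fun t _ => sqError_le_add _ _ _ ha

end Block

/-! ### Source and reconstruction given the codeword -/

instance BinaryPrefixCode.instCountableCodeword (C : BinaryPrefixCode) : Countable C.Codeword :=
  inferInstanceAs (Countable {w : List Bool // w ∈ C.words})

instance BinaryPrefixCode.instDiscreteMeasurableSpaceCodeword (C : BinaryPrefixCode) :
    DiscreteMeasurableSpace C.Codeword := ⟨fun _ => trivial⟩

theorem measure_mul_lintegral_cond {Ω : Type*} [MeasurableSpace Ω] (J : Measure Ω)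
    [IsFiniteMeasure J] (s : Set Ω) (h : Ω → ℝ≥0∞) :
    J s * ∫⁻ z, h z ∂(ProbabilityTheory.cond J s) = ∫⁻ z in s, h z ∂J := by
  rw [ProbabilityTheory.cond, lintegral_smul_measure, smul_eq_mul]
  rcases eq_or_ne (J s) 0 with h0 | h0
  · rw [h0, zero_mul, Measure.restrict_eq_zero.mpr h0, lintegral_zero_measure]
  · rw [← mul_assoc, ENNReal.mul_inv_cancel h0 (measure_ne_top J s), one_mul]

section JointLaw

variable {α : Type*} [MeasurableSpace α] {μ : Measure α} [IsProbabilityMeasure μ] {n : ℕ}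
  {C : BinaryPrefixCode} {enc : Kernel (Fin n → α) C.Codeword} {dec : Kernel C.Codeword (Fin n → α)}
  [IsMarkovKernel enc] [IsMarkovKernel dec]

instance : IsProbabilityMeasure (jointLaw μ enc dec) := by
  unfold jointLaw
  infer_instance

theorem map_fst_jointLaw : (jointLaw μ enc dec).map Prod.fst = Measure.pi fun _ : Fin n => μ :=
  Measure.fst_compProd _ _

theorem lintegral_jointLaw {h : (Fin n → α) × (C.Codeword × (Fin n → α)) → ℝ≥0∞}
    (hh : Measurable h) :
    ∫⁻ z, h z ∂(jointLaw μ enc dec) =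
      ∑' m, ∫⁻ x, enc x {m} * ∫⁻ y, h (x, m, y) ∂(dec m) ∂(Measure.pi fun _ : Fin n => μ) := by
  rw [jointLaw, Measure.lintegral_compProd hh, ← lintegral_tsum]
  · refine lintegral_congr fun x => ?_
    rw [Kernel.lintegral_compProd _ _ _ (by fun_prop), lintegral_countable']
    exact tsum_congr fun m => mul_comm _ _
  · intro m
    refine ((Kernel.measurable_coe enc (MeasurableSet.singleton m)).mul ?_).aemeasurable
    exact Measurable.lintegral_prod_right' (f := fun p : (Fin n → α) × (Fin n → α) =>
      h (p.1, m, p.2)) (by fun_prop)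

theorem measurableSet_codeword (m : C.Codeword) :
    MeasurableSet {z : (Fin n → α) × (C.Codeword × (Fin n → α)) | z.2.1 = m} :=
  (measurable_fst.comp measurable_snd) (MeasurableSet.singleton m)

theorem setLIntegral_jointLaw {h : (Fin n → α) × (C.Codeword × (Fin n → α)) → ℝ≥0∞}
    (hh : Measurable h) (m : C.Codeword) :
    ∫⁻ z in {z | z.2.1 = m}, h z ∂(jointLaw μ enc dec) =
      ∫⁻ x, enc x {m} * ∫⁻ y, h (x, m, y) ∂(dec m) ∂(Measure.pi fun _ : Fin n => μ) := by
  rw [← lintegral_indicator (measurableSet_codeword m),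
    lintegral_jointLaw (hh.indicator (measurableSet_codeword m)), tsum_eq_single m]
  · simp
  · intro m' hm'
    simp [Set.indicator, hm']

theorem lintegral_condSource {g : (Fin n → α) → ℝ≥0∞} (hg : Measurable g) (m : C.Codeword) :
    jointLaw μ enc dec {z | z.2.1 = m} * ∫⁻ x, g x ∂(condSource (jointLaw μ enc dec) m) =
      ∫⁻ x, enc x {m} * g x ∂(Measure.pi fun _ : Fin n => μ) := by
  rw [condSource, lintegral_map hg (by fun_prop), measure_mul_lintegral_cond,
    setLIntegral_jointLaw (by fun_prop)]
  simp

theorem measure_codeword (m : C.Codeword) :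
    jointLaw μ enc dec {z | z.2.1 = m} =
      ∫⁻ x, enc x {m} ∂(Measure.pi fun _ : Fin n => μ) := by
  rw [← setLIntegral_one, setLIntegral_jointLaw measurable_const]
  simp

theorem condRecon_eq {m : C.Codeword} (hm : jointLaw μ enc dec {z | z.2.1 = m} ≠ 0) :
    condRecon (jointLaw μ enc dec) m = dec m := by
  ext A hA
  rw [← ENNReal.mul_right_inj hm (measure_ne_top _ _), ← lintegral_indicator_one hA, condRecon,
    lintegral_map (measurable_one.indicator hA) (by fun_prop), measure_mul_lintegral_cond,
    setLIntegral_jointLaw (h := fun z => A.indicator 1 z.2.2)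
      ((measurable_one.indicator hA).comp (measurable_snd.comp measurable_snd))]
  simp only [lintegral_indicator_one hA]
  rw [lintegral_mul_const _ (Kernel.measurable_coe enc (MeasurableSet.singleton m)),
    measure_codeword]

theorem isProbabilityMeasure_condSource {m : C.Codeword}
    (hm : jointLaw μ enc dec {z | z.2.1 = m} ≠ 0) :
    IsProbabilityMeasure (condSource (jointLaw μ enc dec) m) := by
  have := cond_isProbabilityMeasure hm
  exact Measure.isProbabilityMeasure_map (by fun_prop)

/-- Source and reconstruction are independent given the codeword. The conditional laws are junk
for codewords of probability zero, which contribute zero to the sum. -/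
theorem lintegral_jointLaw_eq_tsum {h : (Fin n → α) × (C.Codeword × (Fin n → α)) → ℝ≥0∞}
    (hh : Measurable h) :
    ∫⁻ z, h z ∂(jointLaw μ enc dec) = ∑' m, jointLaw μ enc dec {z | z.2.1 = m} *
      ∫⁻ x, ∫⁻ y, h (x, m, y) ∂(condRecon (jointLaw μ enc dec) m)
        ∂(condSource (jointLaw μ enc dec) m) := by
  rw [lintegral_jointLaw hh]
  refine tsum_congr fun m => ?_
  have hg : Measurable fun x => ∫⁻ y, h (x, m, y) ∂(dec m) :=
    Measurable.lintegral_prod_right' (f := fun p : (Fin n → α) × (Fin n → α) =>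
      h (p.1, m, p.2)) (by fun_prop)
  rw [← lintegral_condSource (enc := enc) (dec := dec) hg m]
  by_cases hm : jointLaw μ enc dec {z | z.2.1 = m} = 0
  · rw [hm, zero_mul, zero_mul]
  · rw [condRecon_eq hm]

theorem lintegral_jointLaw_source {h : C.Codeword → (Fin n → α) → ℝ≥0∞}
    (hh : ∀ m, Measurable (h m)) :
    ∫⁻ z, h z.2.1 z.1 ∂(jointLaw μ enc dec) = ∑' m, jointLaw μ enc dec {z | z.2.1 = m} *
      ∫⁻ x, h m x ∂(condSource (jointLaw μ enc dec) m) := by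
  have hm : Measurable fun p : C.Codeword × (Fin n → α) => h p.1 p.2 :=
    measurable_from_prod_countable_right hh
  have hz : Measurable fun z : (Fin n → α) × (C.Codeword × (Fin n → α)) => (z.2.1, z.1) := by
    fun_prop
  rw [lintegral_jointLaw_eq_tsum (h := fun z => h z.2.1 z.1) (hm.comp hz)]
  refine tsum_congr fun m => ?_
  by_cases hm : jointLaw μ enc dec {z | z.2.1 = m} = 0
  · rw [hm, zero_mul, zero_mul]
  · rw [condRecon_eq hm]
    simp

end JointLaw

section SquaredError

variable {L n : ℕ} {μ : Measure (EuclideanSpace ℝ (Fin L))} [IsProbabilityMeasure μ]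
  {C : BinaryPrefixCode} {enc : Kernel (Fin n → EuclideanSpace ℝ (Fin L)) C.Codeword}
  {dec : Kernel C.Codeword (Fin n → EuclideanSpace ℝ (Fin L))}
  [IsMarkovKernel enc] [IsMarkovKernel dec]

theorem memLp_condSource
    (hfin : ∀ l, MemLp (fun x : EuclideanSpace ℝ (Fin L) => x l) 2 μ) {m : C.Codeword}
    (hm : jointLaw μ enc dec {z | z.2.1 = m} ≠ 0) (t : Fin n) (l : Fin L) :
    MemLp (fun x : Fin n → EuclideanSpace ℝ (Fin L) => x t l) 2
      (condSource (jointLaw μ enc dec) m) := by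
  have h1 : MemLp (fun x : Fin n → EuclideanSpace ℝ (Fin L) => x t l) 2
      (Measure.pi fun _ : Fin n => μ) :=
    (hfin l).comp_measurePreserving (measurePreserving_eval (fun _ : Fin n => μ) t)
  refine h1.of_measure_le_smul (ENNReal.inv_ne_top.mpr hm) ?_
  rw [condSource, ProbabilityTheory.cond, Measure.map_smul,
    ← map_fst_jointLaw (μ := μ) (enc := enc) (dec := dec)]
  gcongr
  · exact measurable_fst
  · exact Measure.restrict_le_self

/-- The conditional mean of the source given the codeword. -/
def decoderMean (J : Measure ((Fin n → EuclideanSpace ℝ (Fin L)) ×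
    (C.Codeword × (Fin n → EuclideanSpace ℝ (Fin L))))) (m : C.Codeword) (t : Fin n) :
    EuclideanSpace ℝ (Fin L) :=
  blockMean (condSource J m) t

/-- The conditional mean predicts each source coordinate at least as well as the unconditional
mean. -/
theorem lintegral_sq_sub_decoderMean_le
    (hfin : ∀ l, MemLp (fun x : EuclideanSpace ℝ (Fin L) => x l) 2 μ) (t : Fin n) (l : Fin L) :
    ∫⁻ z, ENNReal.ofReal ((z.1 t l - decoderMean (jointLaw μ enc dec) z.2.1 t l) ^ 2)
        ∂(jointLaw μ enc dec) ≤
      ENNReal.ofReal (variance (fun x : EuclideanSpace ℝ (Fin L) => x l) μ) := by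
  set a := ∫ x, x l ∂μ
  calc _ ≤ ∫⁻ z, ENNReal.ofReal ((z.1 t l - a) ^ 2) ∂(jointLaw μ enc dec) := by
        rw [lintegral_jointLaw_source (h := fun m (x : Fin n → EuclideanSpace ℝ (Fin L)) =>
            ENNReal.ofReal ((x t l - decoderMean (jointLaw μ enc dec) m t l) ^ 2))
            fun m => by fun_prop,
          lintegral_jointLaw_source (h := fun _ (x : Fin n → EuclideanSpace ℝ (Fin L)) =>
            ENNReal.ofReal ((x t l - a) ^ 2)) fun m => by fun_prop]
        refine ENNReal.tsum_le_tsum fun m => ?_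
        by_cases hm : jointLaw μ enc dec {z | z.2.1 = m} = 0
        · rw [hm, zero_mul, zero_mul]
        · have := isProbabilityMeasure_condSource hm
          refine mul_le_mul_right ?_ _
          rw [lintegral_sq_sub_eq (memLp_condSource hfin hm t l) a]
          exact le_self_add
    _ = ∫⁻ x, ENNReal.ofReal ((x l - a) ^ 2) ∂μ := by
        rw [← (measurePreserving_eval (fun _ : Fin n => μ) t).lintegral_comp (by fun_prop),
          ← map_fst_jointLaw (μ := μ) (enc := enc) (dec := dec),
          lintegral_map (by fun_prop) measurable_fst]
    _ = _ := by
        rw [(hfin l).ofReal_variance_eq, evariance_eq_lintegral_ofReal]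

/-- The distortion splits into the error of the conditional mean and the squared distance of the
reconstruction from the conditional mean. -/
theorem lintegral_distortion_eq
    (hfin : ∀ l, MemLp (fun x : EuclideanSpace ℝ (Fin L) => x l) 2 μ) :
    ∫⁻ z, ∑ t, sqError (z.1 t) (z.2.2 t) ∂(jointLaw μ enc dec) =
      (∑' m, jointLaw μ enc dec {z | z.2.1 = m} *
        ∫⁻ x, ∑ t, sqError (x t) (decoderMean (jointLaw μ enc dec) m t)
          ∂(condSource (jointLaw μ enc dec) m)) +
      ∑' m, jointLaw μ enc dec {z | z.2.1 = m} *
        ∫⁻ y, ∑ t, sqError (y t) (decoderMean (jointLaw μ enc dec) m t)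
          ∂(condRecon (jointLaw μ enc dec) m) := by
  rw [lintegral_jointLaw_eq_tsum (h := fun z => ∑ t, sqError (z.1 t) (z.2.2 t)) (by fun_prop),
    ← ENNReal.tsum_add]
  refine tsum_congr fun m => ?_
  by_cases hm : jointLaw μ enc dec {z | z.2.1 = m} = 0
  · rw [hm, zero_mul, zero_mul, zero_mul, zero_add]
  · have := isProbabilityMeasure_condSource hm
    rw [condRecon_eq hm, ← mul_add]
    congr 1
    exact lintegral_lintegral_sum_sqError_eq fun t l => memLp_condSource hfin hm t l

/-- Under the distortion and perception constraints, the total error of the conditional mean is at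
most `n D*`. -/
theorem lintegral_sum_sqError_decoderMean_le
    (hfin : ∀ l, MemLp (fun x : EuclideanSpace ℝ (Fin L) => x l) 2 μ) (hn : 1 ≤ n) {D P : ℝ}
    (hD : 0 < D) (hP : 0 ≤ P)
    (hdist : (∫⁻ z, ∑ t, sqError (z.1 t) (z.2.2 t) ∂(jointLaw μ enc dec)) / n ≤ ENNReal.ofReal D)
    (hperc : (∫⁻ z, divergence sqError (condSource (jointLaw μ enc dec) z.2.1)
      (condRecon (jointLaw μ enc dec) z.2.1) ∂(jointLaw μ enc dec)) / n ≤ ENNReal.ofReal P) :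
    ∫⁻ z, ∑ t, sqError (z.1 t) (decoderMean (jointLaw μ enc dec) z.2.1 t) ∂(jointLaw μ enc dec) ≤
      ENNReal.ofReal (n * effectiveDistortion D P) := by
  have hn0 : (0 : ℝ) < n := by exact_mod_cast hn
  have hnE : (n : ℝ≥0∞) ≠ 0 := by exact_mod_cast (Nat.one_le_iff_ne_zero.mp hn)
  have hmul : ∀ x : ℝ, ENNReal.ofReal x * n = ENNReal.ofReal (n * x) := fun x => by
    rw [ENNReal.ofReal_mul hn0.le, ENNReal.ofReal_natCast, mul_comm]
  rw [ENNReal.div_le_iff hnE (ENNReal.natCast_ne_top n), hmul] at hdist hperc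
  rw [lintegral_distortion_eq hfin] at hdist
  rw [lintegral_jointLaw_source (h := fun m _ => divergence sqError
    (condSource (jointLaw μ enc dec) m) (condRecon (jointLaw μ enc dec) m))
    fun m => measurable_const] at hperc
  rw [lintegral_jointLaw_source (h := fun m (x : Fin n → EuclideanSpace ℝ (Fin L)) =>
    ∑ t, sqError (x t) (decoderMean (jointLaw μ enc dec) m t)) fun m => by fun_prop]
  set V := ∑' m, jointLaw μ enc dec {z | z.2.1 = m} *
        ∫⁻ x, ∑ t, sqError (x t) (decoderMean (jointLaw μ enc dec) m t)
          ∂(condSource (jointLaw μ enc dec) m) with hV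
  set B := ∑' m, jointLaw μ enc dec {z | z.2.1 = m} *
        ∫⁻ y, ∑ t, sqError (y t) (decoderMean (jointLaw μ enc dec) m t)
          ∂(condRecon (jointLaw μ enc dec) m) with hB
  have htri : ∀ a : ℝ, 0 < a → V ≤ ENNReal.ofReal (1 + a) * ENNReal.ofReal (n * P) +
      ENNReal.ofReal (1 + a⁻¹) * B := by
    intro a ha
    refine le_trans ?_ (add_le_add_left (mul_le_mul_right hperc (ENNReal.ofReal (1 + a))) _)
    rw [hV, hB, ← ENNReal.tsum_mul_left, ← ENNReal.tsum_mul_left, ← ENNReal.tsum_add]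
    refine ENNReal.tsum_le_tsum fun m => ?_
    by_cases hm : jointLaw μ enc dec {z | z.2.1 = m} = 0
    · simp [hm]
    · have := isProbabilityMeasure_condSource hm
      rw [lintegral_const, measure_univ, mul_one]
      calc _ ≤ jointLaw μ enc dec {z | z.2.1 = m} * _ :=
            mul_le_mul_right (lintegral_sum_sqError_le_divergence
              (ρ := condRecon (jointLaw μ enc dec) m) _ ha) _
        _ = _ := by ring
  have hVtop : V ≠ ⊤ := ne_top_of_le_ne_top ENNReal.ofReal_ne_top (le_self_add.trans hdist)
  have hBtop : B ≠ ⊤ := ne_top_of_le_ne_top ENNReal.ofReal_ne_top (le_add_self.trans hdist)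
  rw [← ENNReal.ofReal_toReal hVtop, ← ENNReal.ofReal_toReal hBtop] at htri hdist
  rw [← ENNReal.ofReal_toReal hVtop]
  refine ENNReal.ofReal_le_ofReal ?_
  rw [← ENNReal.ofReal_add ENNReal.toReal_nonneg ENNReal.toReal_nonneg,
    ENNReal.ofReal_le_ofReal_iff (by positivity)] at hdist
  have h := le_effectiveDistortion (V := V.toReal / n) (B := B.toReal / n) hD hP (by positivity)
    (by rw [← add_div, div_le_iff₀ hn0]; linarith) fun a ha => by
      have ha' : 0 < a⁻¹ := inv_pos.mpr ha
      have h1 := htri a ha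
      rw [← ENNReal.ofReal_mul (by positivity), ← ENNReal.ofReal_mul (by positivity),
        ← ENNReal.ofReal_add (by positivity) (by positivity),
        ENNReal.ofReal_le_ofReal_iff (by positivity)] at h1
      rw [div_le_iff₀ hn0]
      calc _ ≤ _ := h1
        _ = _ := by field_simp
  rw [div_le_iff₀ hn0] at h
  linarith

end SquaredError

/-! ### Comparison of the source density with a Gaussian mixture -/

section Mixture

variable {L n : ℕ} {μ : Measure (EuclideanSpace ℝ (Fin L))} {C : BinaryPrefixCode}

/-- The ratio of the mixture of the Gaussian product densities with means `c m` and coordinate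
variances `v`, mixed with the Kraft weights, to the density of the i.i.d. source sequence. -/
def mixtureRatio (μ : Measure (EuclideanSpace ℝ (Fin L))) {C : BinaryPrefixCode} (v : Fin L → ℝ≥0)
    (c : C.Codeword → Fin n → EuclideanSpace ℝ (Fin L))
    (x : Fin n → EuclideanSpace ℝ (Fin L)) : ℝ≥0∞ :=
  ∑' m, C.weight m * ∏ t, (gaussianDensity (c m t) v (x t) / μ.rnDeriv volume (x t))

theorem measurable_gaussianDensity_div (v : Fin L → ℝ≥0) (c : EuclideanSpace ℝ (Fin L)) :
    Measurable fun x => gaussianDensity c v x / μ.rnDeriv volume x :=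
  (measurable_gaussianDensity _ _).div (Measure.measurable_rnDeriv μ volume)

theorem measurable_prod_gaussianDensity_div (v : Fin L → ℝ≥0)
    (c : Fin n → EuclideanSpace ℝ (Fin L)) :
    Measurable fun x : Fin n → EuclideanSpace ℝ (Fin L) =>
      ∏ t, (gaussianDensity (c t) v (x t) / μ.rnDeriv volume (x t)) :=
  Finset.measurable_prod _ fun t _ =>
    (measurable_gaussianDensity_div v (c t)).comp (measurable_pi_apply t)

theorem measurable_mixtureRatio (v : Fin L → ℝ≥0)
    (c : C.Codeword → Fin n → EuclideanSpace ℝ (Fin L)) : Measurable (mixtureRatio μ v c) :=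
  Measurable.tsum fun m => (measurable_prod_gaussianDensity_div v (c m)).const_mul _

theorem lintegral_mixtureRatio_le_one [IsProbabilityMeasure μ] (hac : μ ≪ volume) {v : Fin L → ℝ≥0}
    (hv : ∀ l, v l ≠ 0) (c : C.Codeword → Fin n → EuclideanSpace ℝ (Fin L)) :
    ∫⁻ x, mixtureRatio μ v c x ∂(Measure.pi fun _ : Fin n => μ) ≤ 1 := by
  simp only [mixtureRatio]
  rw [lintegral_tsum fun m =>
    ((measurable_prod_gaussianDensity_div v (c m)).const_mul _).aemeasurable]
  refine le_trans (ENNReal.tsum_le_tsum fun m => ?_) C.tsum_weight_le_one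
  rw [lintegral_const_mul _ (measurable_prod_gaussianDensity_div v (c m)),
    lintegral_fin_pi_prod _ (fun t x => gaussianDensity (c m t) v x / μ.rnDeriv volume x)
      fun t => measurable_gaussianDensity_div v (c m t)]
  refine mul_le_of_le_one_right' (Finset.prod_le_one' fun t _ => ?_)
  exact (lintegral_div_rnDeriv_le hac (measurable_gaussianDensity _ _)).trans
    (lintegral_gaussianDensity _ hv).le

/-- Since `C.weight m` times the `m`-th Gaussian density is at most the mixture, `log r ≤ r - 1`
bounds the log-density of the source by the codeword length and a quadratic form. -/
theorem sum_neg_log_rnDeriv_le {v : Fin L → ℝ≥0} (hv : ∀ l, v l ≠ 0)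
    (c : C.Codeword → Fin n → EuclideanSpace ℝ (Fin L)) (m : C.Codeword)
    {x : Fin n → EuclideanSpace ℝ (Fin L)} (hx : ∀ t, 0 < (μ.rnDeriv volume (x t)).toReal)
    (hR : mixtureRatio μ v c x ≠ ⊤) :
    ∑ t, -Real.log (μ.rnDeriv volume (x t)).toReal ≤
      (mixtureRatio μ v c x).toReal - 1 + Real.log 2 * C.length m +
        ∑ t, ∑ l, (1 / 2 * Real.log (2 * Real.pi * v l) + (x t l - c m t l) ^ 2 / (2 * v l)) := by
  set r := (C.weight m * ∏ t, (gaussianDensity (c m t) v (x t) / μ.rnDeriv volume (x t))).toReal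
    with hr
  have hr1 : r ≤ (mixtureRatio μ v c x).toReal := ENNReal.toReal_mono hR
    (ENNReal.le_tsum (f := fun m => C.weight m *
      ∏ t, (gaussianDensity (c m t) v (x t) / μ.rnDeriv volume (x t))) m)
  have hw : (C.weight m).toReal = (1 / 2) ^ C.length m := ENNReal.toReal_ofReal (by positivity)
  have hg : ∀ t, 0 < (gaussianDensity (c m t) v (x t)).toReal := fun t =>
    gaussianDensity_pos _ hv _
  have hq : ∀ t, 0 < (gaussianDensity (c m t) v (x t)).toReal / (μ.rnDeriv volume (x t)).toReal :=
    fun t => div_pos (hg t) (hx t)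
  rw [ENNReal.toReal_mul, hw, ENNReal.toReal_prod] at hr
  simp only [ENNReal.toReal_div] at hr
  have hprod := Finset.prod_pos fun t (_ : t ∈ Finset.univ) => hq t
  have hr0 : 0 < r := hr ▸ mul_pos (by positivity) hprod
  have hlog : Real.log r = -(Real.log 2 * C.length m) +
      ∑ t, (Real.log (gaussianDensity (c m t) v (x t)).toReal -
        Real.log (μ.rnDeriv volume (x t)).toReal) := by
    rw [hr, Real.log_mul (by positivity) hprod.ne', Real.log_pow,
      Real.log_prod fun t _ => (hq t).ne']
    simp only [Real.log_div (hg _).ne' (hx _).ne', one_div, Real.log_inv]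
    ring
  have h1 := Real.log_le_sub_one_of_pos hr0
  rw [hlog, Finset.sum_sub_distrib] at h1
  have h2 : ∑ t, ∑ l, (1 / 2 * Real.log (2 * Real.pi * v l) +
      (x t l - c m t l) ^ 2 / (2 * v l)) =
      -∑ t, Real.log (gaussianDensity (c m t) v (x t)).toReal := by
    rw [← Finset.sum_neg_distrib]
    exact Finset.sum_congr rfl fun t _ => (neg_log_gaussianDensity _ hv _).symm
  rw [h2, Finset.sum_neg_distrib]
  linarith

end Mixture

/-- The integrated bound: `n h(X)` is at most the expected codeword length in nats plus the
expected negative log-density of Gaussian vectors centred at a function of the codeword. -/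
theorem card_mul_entropy_le {L n : ℕ} {μ : Measure (EuclideanSpace ℝ (Fin L))}
    [IsProbabilityMeasure μ] {C : BinaryPrefixCode}
    {J : Measure ((Fin n → EuclideanSpace ℝ (Fin L)) ×
      (C.Codeword × (Fin n → EuclideanSpace ℝ (Fin L))))} [IsProbabilityMeasure J]
    (hJ : J.map Prod.fst = Measure.pi fun _ : Fin n => μ) (hac : μ ≪ volume)
    (hint : Integrable (fun x => -Real.log (μ.rnDeriv volume x).toReal) μ)
    {v : Fin L → ℝ≥0} (hv : ∀ l, v l ≠ 0) (c : C.Codeword → Fin n → EuclideanSpace ℝ (Fin L))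
    (hlen : ∫⁻ z, (C.length z.2.1 : ℝ≥0∞) ∂J ≠ ⊤)
    (hsq : ∀ t l, ∫⁻ z, ENNReal.ofReal ((z.1 t l - c z.2.1 t l) ^ 2) ∂J ≠ ⊤) :
    n * ∫ x, -Real.log (μ.rnDeriv volume x).toReal ∂μ ≤
      Real.log 2 * (∫⁻ z, (C.length z.2.1 : ℝ≥0∞) ∂J).toReal +
        ∑ t, ∑ l, (1 / 2 * Real.log (2 * Real.pi * v l) +
          (∫⁻ z, ENNReal.ofReal ((z.1 t l - c z.2.1 t l) ^ 2) ∂J).toReal / (2 * v l)) := by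
  have hpres : MeasurePreserving Prod.fst J (Measure.pi fun _ : Fin n => μ) := ⟨measurable_fst, hJ⟩
  have hcoord : ∀ t : Fin n, MeasurePreserving (fun z => z.1 t) J μ := fun t =>
    (measurePreserving_eval (fun _ : Fin n => μ) t).comp hpres
  have hcode : ∀ f : C.Codeword → ℝ, Measurable f := fun f => measurable_of_countable f
  have hsqm : ∀ t l, Measurable fun z : (Fin n → EuclideanSpace ℝ (Fin L)) ×
      (C.Codeword × (Fin n → EuclideanSpace ℝ (Fin L))) => (z.1 t l - c z.2.1 t l) ^ 2 := by
    intro t l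
    have h1 : Measurable fun z : (Fin n → EuclideanSpace ℝ (Fin L)) ×
        (C.Codeword × (Fin n → EuclideanSpace ℝ (Fin L))) => c z.2.1 t l :=
      (hcode fun m => c m t l).comp (measurable_fst.comp measurable_snd)
    fun_prop
  have hmix : ∫⁻ z, mixtureRatio μ v c z.1 ∂J ≤ 1 := by
    rw [hpres.lintegral_comp (measurable_mixtureRatio v c)]
    exact lintegral_mixtureRatio_le_one hac hv c
  have hmix' : ∫⁻ z, mixtureRatio μ v c z.1 ∂J ≠ ⊤ := ne_top_of_le_ne_top ENNReal.one_ne_top hmix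
  have hmixm : Measurable fun z : (Fin n → EuclideanSpace ℝ (Fin L)) ×
      (C.Codeword × (Fin n → EuclideanSpace ℝ (Fin L))) => mixtureRatio μ v c z.1 :=
    (measurable_mixtureRatio v c).comp measurable_fst
  have hlenm : Measurable fun z : (Fin n → EuclideanSpace ℝ (Fin L)) ×
      (C.Codeword × (Fin n → EuclideanSpace ℝ (Fin L))) => (C.length z.2.1 : ℝ≥0∞) :=
    (measurable_of_countable fun m : C.Codeword => (C.length m : ℝ≥0∞)).comp
      (measurable_fst.comp measurable_snd)
  have i1 : Integrable (fun z => (mixtureRatio μ v c z.1).toReal) J :=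
    integrable_toReal_of_lintegral_ne_top hmixm.aemeasurable hmix'
  have i2 : Integrable (fun z => Real.log 2 * (C.length z.2.1 : ℝ)) J := by
    have := integrable_toReal_of_lintegral_ne_top hlenm.aemeasurable hlen
    simp only [ENNReal.toReal_natCast] at this
    exact this.const_mul _
  have i3 : ∀ t l, Integrable (fun z => (z.1 t l - c z.2.1 t l) ^ 2) J := fun t l =>
    (lintegral_ofReal_ne_top_iff_integrable (hsqm t l).aestronglyMeasurable
      (ae_of_all _ fun _ => sq_nonneg _)).mp (hsq t l)
  have i4 : ∀ t l, Integrable (fun z => 1 / 2 * Real.log (2 * Real.pi * v l) +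
      (z.1 t l - c z.2.1 t l) ^ 2 / (2 * v l)) J := fun t l =>
    (integrable_const _).add ((i3 t l).div_const _)
  have i5 : ∀ t, Integrable (fun z => -Real.log (μ.rnDeriv volume (z.1 t)).toReal) J := fun t =>
    (hcoord t).integrable_comp_of_integrable hint
  have e1 : ∫ z, (mixtureRatio μ v c z.1).toReal ∂J ≤ 1 := by
    rw [integral_toReal hmixm.aemeasurable (ae_lt_top hmixm hmix')]
    exact ENNReal.toReal_le_of_le_ofReal zero_le_one (by simpa using hmix)
  have e2 : ∫ z, (C.length z.2.1 : ℝ) ∂J = (∫⁻ z, (C.length z.2.1 : ℝ≥0∞) ∂J).toReal := by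
    rw [← integral_toReal hlenm.aemeasurable (ae_lt_top hlenm hlen)]
    simp only [ENNReal.toReal_natCast]
  have e3 : ∀ t l, ∫ z, (z.1 t l - c z.2.1 t l) ^ 2 ∂J =
      (∫⁻ z, ENNReal.ofReal ((z.1 t l - c z.2.1 t l) ^ 2) ∂J).toReal := fun t l =>
    integral_eq_lintegral_of_nonneg_ae (ae_of_all _ fun _ => sq_nonneg _)
      (hsqm t l).aestronglyMeasurable
  have e5 : ∀ t : Fin n, ∫ z, -Real.log (μ.rnDeriv volume (z.1 t)).toReal ∂J =
      ∫ x, -Real.log (μ.rnDeriv volume x).toReal ∂μ := fun t => by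
    have h := integral_map (hcoord t).measurable.aemeasurable
      (f := fun x => -Real.log (μ.rnDeriv volume x).toReal)
      (by rw [(hcoord t).map_eq]; exact hint.aestronglyMeasurable)
    rw [(hcoord t).map_eq] at h
    exact h.symm
  have hae : ∀ᵐ z ∂J, ∑ t, -Real.log (μ.rnDeriv volume (z.1 t)).toReal ≤
      (mixtureRatio μ v c z.1).toReal - 1 + Real.log 2 * C.length z.2.1 +
        ∑ t, ∑ l, (1 / 2 * Real.log (2 * Real.pi * v l) +
          (z.1 t l - c z.2.1 t l) ^ 2 / (2 * v l)) := by
    have h1 : ∀ᵐ z ∂J, ∀ t, 0 < (μ.rnDeriv volume (z.1 t)).toReal :=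
      ae_all_iff.mpr fun t => (hcoord t).quasiMeasurePreserving.ae (rnDeriv_toReal_pos hac)
    filter_upwards [h1, ae_lt_top hmixm hmix'] with z hz1 hz2
    exact sum_neg_log_rnDeriv_le hv c z.2.1 hz1 hz2.ne
  have i6 : Integrable (fun z => (mixtureRatio μ v c z.1).toReal - 1) J :=
    i1.sub (integrable_const _)
  have i7 : Integrable (fun z => (mixtureRatio μ v c z.1).toReal - 1 +
      Real.log 2 * C.length z.2.1) J := i6.add i2
  have i8 : Integrable (fun z => ∑ t, ∑ l, (1 / 2 * Real.log (2 * Real.pi * v l) +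
          (z.1 t l - c z.2.1 t l) ^ 2 / (2 * v l))) J :=
    integrable_finsetSum _ fun t _ => integrable_finsetSum _ fun l _ => i4 t l
  have hmono := integral_mono_ae (integrable_finsetSum _ fun t _ => i5 t) (i7.add i8) hae
  have hR : ∫ z, ((mixtureRatio μ v c z.1).toReal - 1 + Real.log 2 * C.length z.2.1 +
        ∑ t, ∑ l, (1 / 2 * Real.log (2 * Real.pi * v l) +
          (z.1 t l - c z.2.1 t l) ^ 2 / (2 * v l))) ∂J =
      ∫ z, (mixtureRatio μ v c z.1).toReal ∂J - 1 +
        Real.log 2 * (∫⁻ z, (C.length z.2.1 : ℝ≥0∞) ∂J).toReal +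
        ∑ t, ∑ l, (1 / 2 * Real.log (2 * Real.pi * v l) +
          (∫⁻ z, ENNReal.ofReal ((z.1 t l - c z.2.1 t l) ^ 2) ∂J).toReal / (2 * v l)) := by
    rw [integral_add i7 i8, integral_add i6 i2, integral_sub i1 (integrable_const _),
      integral_const_mul, e2, integral_finsetSum _ fun t _ => integrable_finsetSum _ fun l _ => i4 t l]
    congr 1
    · simp
    · refine Finset.sum_congr rfl fun t _ => ?_
      rw [integral_finsetSum _ fun l _ => i4 t l]
      refine Finset.sum_congr rfl fun l _ => ?_
      rw [integral_add (integrable_const _) ((i3 t l).div_const _), integral_div, e3]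
      simp
  rw [integral_finsetSum _ fun t _ => i5 t] at hmono
  simp only [e5, Finset.sum_const, Finset.card_univ, Fintype.card_fin, nsmul_eq_mul] at hmono
  refine hmono.trans (hR.le.trans ?_)
  linarith

/-! ### The bound for achievable rates -/

/-- The lower bound, in nats per symbol, for a single achievable rate. -/
theorem entropy_sub_le_of_achievable {L : ℕ} {μ : Measure (EuclideanSpace ℝ (Fin L))}
    [IsProbabilityMeasure μ] {σsq : Fin L → ℝ}
    (hσ : ∀ l, σsq l = variance (fun x => x l) μ)
    (hfin : ∀ l, MemLp (fun x : EuclideanSpace ℝ (Fin L) => x l) 2 μ)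
    (hpos : ∀ l, 0 < σsq l) (hac : μ ≪ volume)
    (hint : Integrable (fun x => -Real.log (μ.rnDeriv volume x).toReal) μ)
    {D P ω : ℝ} (hD : 0 < D) (hP : 0 ≤ P)
    (hω : effectiveDistortion D P < ∑ l, σsq l → ∑ l, min ω (σsq l) = effectiveDistortion D P)
    {R : ℝ≥0} (hR : Achievable μ sqError sqError (ENNReal.ofReal D) (ENNReal.ofReal P) R) :
    ∫ x, -Real.log (μ.rnDeriv volume x).toReal ∂μ -
      ∑ l, 1 / 2 * Real.log (2 * Real.pi * Real.exp 1 *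
        waterFill σsq (effectiveDistortion D P) ω l) ≤ Real.log 2 * R := by
  obtain ⟨n, hn, C, enc, dec, henc, hdec, hrate, hdist, hperc⟩ := hR
  have hn0 : (0 : ℝ) < n := by exact_mod_cast hn
  have hnE : (n : ℝ≥0∞) ≠ 0 := by exact_mod_cast (Nat.one_le_iff_ne_zero.mp hn)
  have hd : 0 < effectiveDistortion D P := effectiveDistortion_pos hD
  have hw := waterFill_pos hpos hd hω
  set w := waterFill σsq (effectiveDistortion D P) ω with hwdef
  set J := jointLaw μ enc dec with hJ
  set c := decoderMean J with hc
  set s : Fin n → Fin L → ℝ := fun t l =>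
    (∫⁻ z, ENNReal.ofReal ((z.1 t l - c z.2.1 t l) ^ 2) ∂J).toReal with hs
  have hvar : ∀ t l, ∫⁻ z, ENNReal.ofReal ((z.1 t l - c z.2.1 t l) ^ 2) ∂J ≤
      ENNReal.ofReal (σsq l) := fun t l => by
    rw [hσ l]
    exact lintegral_sq_sub_decoderMean_le hfin t l
  have hsq : ∀ t l, ∫⁻ z, ENNReal.ofReal ((z.1 t l - c z.2.1 t l) ^ 2) ∂J ≠ ⊤ := fun t l =>
    ne_top_of_le_ne_top ENNReal.ofReal_ne_top (hvar t l)
  have hsσ : ∀ t l, s t l ≤ σsq l := fun t l =>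
    ENNReal.toReal_le_of_le_ofReal (hpos l).le (hvar t l)
  have hsum : ∑ t, ∑ l, s t l ≤ n * effectiveDistortion D P := by
    have h1 := lintegral_sum_sqError_decoderMean_le hfin hn hD hP hdist hperc
    have hm : ∀ t l, Measurable fun z : (Fin n → EuclideanSpace ℝ (Fin L)) ×
        (C.Codeword × (Fin n → EuclideanSpace ℝ (Fin L))) =>
        ENNReal.ofReal ((z.1 t l - c z.2.1 t l) ^ 2) := by
      intro t l
      have h1 : Measurable fun z : (Fin n → EuclideanSpace ℝ (Fin L)) ×
          (C.Codeword × (Fin n → EuclideanSpace ℝ (Fin L))) => c z.2.1 t l :=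
        (measurable_of_countable fun m => c m t l).comp (measurable_fst.comp measurable_snd)
      fun_prop
    simp only [sqError_eq_sum] at h1
    rw [lintegral_finsetSum _ fun t _ => Finset.measurable_sum _ fun l _ => hm t l] at h1
    simp only [lintegral_finsetSum _ fun l _ => hm _ l] at h1
    have h2 := ENNReal.toReal_le_of_le_ofReal (by positivity) h1
    rw [ENNReal.toReal_sum fun t _ => ENNReal.sum_ne_top.mpr fun l _ => hsq t l] at h2
    simpa only [ENNReal.toReal_sum fun l _ => hsq _ l] using h2
  rw [ENNReal.div_le_iff hnE (ENNReal.natCast_ne_top n)] at hrate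
  have hlen : ∫⁻ z, (C.length z.2.1 : ℝ≥0∞) ∂J ≠ ⊤ :=
    ne_top_of_le_ne_top (by finiteness) hrate
  have hlenR : (∫⁻ z, (C.length z.2.1 : ℝ≥0∞) ∂J).toReal ≤ R * n := by
    have := ENNReal.toReal_mono (by finiteness) hrate
    simpa using this
  have hv : ∀ l, (w l).toNNReal ≠ 0 := fun l => (Real.toNNReal_pos.mpr (hw l)).ne'
  have hmain := card_mul_entropy_le map_fst_jointLaw hac hint hv c hlen hsq
  simp only [Real.coe_toNNReal _ (hw _).le] at hmain
  -- the normalized mean squared errors of the coordinates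
  have havg := sum_div_waterFill_le hpos hd hω (v := fun l => (∑ t, s t l) / n)
    (fun l => by
      rw [div_le_iff₀ hn0]
      calc ∑ t, s t l ≤ ∑ _t : Fin n, σsq l := Finset.sum_le_sum fun t _ => hsσ t l
        _ = σsq l * n := by simp [mul_comm])
    (by rw [← Finset.sum_div, Finset.sum_comm, div_le_iff₀ hn0]; linarith)
  have hlog : ∑ l, 1 / 2 * Real.log (2 * Real.pi * Real.exp 1 * w l) =
      ∑ l, 1 / 2 * Real.log (2 * Real.pi * w l) + L / 2 := by
    have : ∀ l, 1 / 2 * Real.log (2 * Real.pi * Real.exp 1 * w l) =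
        1 / 2 * Real.log (2 * Real.pi * w l) + 1 / 2 := fun l => by
      have := hw l
      rw [mul_right_comm, Real.log_mul (by positivity) (Real.exp_pos 1).ne', Real.log_exp]
      ring
    simp only [this, Finset.sum_add_distrib, Finset.sum_const, Finset.card_univ, Fintype.card_fin,
      nsmul_eq_mul]
    ring
  have hsplit : ∑ t, ∑ l, (1 / 2 * Real.log (2 * Real.pi * w l) + s t l / (2 * w l)) =
      n * (∑ l, 1 / 2 * Real.log (2 * Real.pi * w l) + (∑ l, (∑ t, s t l) / n / w l) / 2) := by
    rw [Finset.sum_comm, mul_add, Finset.mul_sum, Finset.sum_div, Finset.mul_sum,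
      ← Finset.sum_add_distrib]
    refine Finset.sum_congr rfl fun l _ => ?_
    rw [Finset.sum_add_distrib, ← Finset.sum_div]
    have := (hw l).ne'
    simp only [Finset.sum_const, Finset.card_univ, Fintype.card_fin, nsmul_eq_mul]
    field_simp
  rw [hsplit] at hmain
  have h3 : Real.log 2 * (∫⁻ z, (C.length z.2.1 : ℝ≥0∞) ∂J).toReal ≤ Real.log 2 * (R * n) :=
    mul_le_mul_of_nonneg_left hlenR (Real.log_nonneg one_le_two)
  have h4 : n * ∫ x, -Real.log (μ.rnDeriv volume x).toReal ∂μ ≤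
      n * (Real.log 2 * R + ∑ l, 1 / 2 * Real.log (2 * Real.pi * w l) + L / 2) := by
    have h5 := mul_le_mul_of_nonneg_left havg hn0.le
    nlinarith
  have h6 := le_of_mul_le_mul_left h4 hn0
  rw [hlog]
  linarith

end RDP

end

theorem theorem4 (L : ℕ)
    (μ : MeasureTheory.Measure (EuclideanSpace ℝ (Fin L)))
    [MeasureTheory.IsProbabilityMeasure μ]
    (σsq : Fin L → ℝ)
    (hσ : ∀ l, σsq l = ProbabilityTheory.variance (fun x => x l) μ)
    (hfin : ∀ l, MeasureTheory.MemLp (fun x : EuclideanSpace ℝ (Fin L) => x l) 2 μ)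
    (hpos : ∀ l, 0 < σsq l)
    (D P : ℝ) (hD : 0 < D) (hP : 0 ≤ P) :
    -- the water level is well defined whenever it is used
    (RDP.effectiveDistortion D P < ∑ l, σsq l →
      ∃! ω : ℝ, ∑ l, min ω (σsq l) = RDP.effectiveDistortion D P) ∧
    ∀ ω : ℝ,
      (RDP.effectiveDistortion D P < ∑ l, σsq l →
        ∑ l, min ω (σsq l) = RDP.effectiveDistortion D P) →
      -- the bound for the rate in binary digits per symbol
      RDP.differentialEntropy μ -
          ((∑ l, 1 / 2 * Real.log (2 * Real.pi * Real.exp 1 *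
            RDP.waterFill σsq (RDP.effectiveDistortion D P) ω l) : ℝ) : EReal)
        ≤ (RDP.operationalRDP μ RDP.sqError RDP.sqError
            (ENNReal.ofReal D) (ENNReal.ofReal P) : EReal) ∧
      -- the bound for the rate in nats per symbol (one binary digit is `log 2` nats)
      RDP.differentialEntropy μ -
          ((∑ l, 1 / 2 * Real.log (2 * Real.pi * Real.exp 1 *
            RDP.waterFill σsq (RDP.effectiveDistortion D P) ω l) : ℝ) : EReal)
        ≤ (Real.log 2 : EReal) * (RDP.operationalRDP μ RDP.sqError RDP.sqError
            (ENNReal.ofReal D) (ENNReal.ofReal P) : EReal) := by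
  refine ⟨RDP.existsUnique_waterLevel hpos (RDP.effectiveDistortion_pos hD), fun ω hω => ?_⟩
  by_cases hbot : RDP.differentialEntropy μ = ⊥
  · rw [hbot, EReal.bot_sub]
    exact ⟨bot_le, bot_le⟩
  obtain ⟨hac, hint, hent⟩ := RDP.differentialEntropy_eq hfin hbot
  rw [hent, ← EReal.coe_sub]
  set b := ∫ x, -Real.log (μ.rnDeriv volume x).toReal ∂μ -
    ∑ l, 1 / 2 * Real.log (2 * Real.pi * Real.exp 1 *
      RDP.waterFill σsq (RDP.effectiveDistortion D P) ω l) with hb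
  have hlog : 0 < Real.log 2 := Real.log_pos one_lt_two
  have hlog1 : Real.log 2 ≤ 1 := by linarith [Real.log_two_lt_d9]
  have hle : ENNReal.ofReal (b / Real.log 2) ≤ RDP.operationalRDP μ RDP.sqError RDP.sqError
      (ENNReal.ofReal D) (ENNReal.ofReal P) := by
    refine le_iInf₂ fun R hR => ?_
    refine ENNReal.ofReal_le_of_le_toReal ?_
    rw [ENNReal.coe_toReal, div_le_iff₀ hlog, mul_comm]
    exact RDP.entropy_sub_le_of_achievable hσ hfin hpos hac hint hD hP hω hR
  have hle' : ((ENNReal.ofReal (b / Real.log 2) : ENNReal) : EReal) ≤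
      (RDP.operationalRDP μ RDP.sqError RDP.sqError (ENNReal.ofReal D) (ENNReal.ofReal P) :
        EReal) := EReal.coe_ennreal_le_coe_ennreal_iff.mpr hle
  rw [EReal.coe_ennreal_ofReal] at hle'
  constructor
  · refine le_trans ?_ hle'
    rw [EReal.coe_le_coe_iff]
    rcases le_total b 0 with h | h
    · exact h.trans (le_max_right _ _)
    · exact (le_div_self h hlog hlog1).trans (le_max_left _ _)
  · calc (b : EReal) ≤ ((Real.log 2 * max (b / Real.log 2) 0 : ℝ) : EReal) := by
          rw [EReal.coe_le_coe_iff]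
          calc b = Real.log 2 * (b / Real.log 2) := by field_simp
            _ ≤ _ := mul_le_mul_of_nonneg_left (le_max_left _ _) hlog.le
      _ = (Real.log 2 : EReal) * ((max (b / Real.log 2) 0 : ℝ) : EReal) := EReal.coe_mul _ _
      _ ≤ _ := mul_le_mul_of_nonneg_left hle' (by exact_mod_cast hlog.le)
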